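/- Theorem 3. Let $L>0$, $\alpha>0$, $\beta>0$. For $\gamma>0$, a rotating fluxon wave with bias $\gamma$ and frequency $\omega$ is a (classical, $C^3$) solution $\phi:\mathbb{R}^2\to\mathbb{R}$ of $$\phi_{tt}+\alpha\phi_t+\sin(\phi)=\phi_{xx}+\beta\phi_{xxt}+\gamma,\qquad \phi(x+L,t)=\phi(x,t)+2\pi,$$ of the form $\phi(x,t)=\theta(kx+\omega t)$, where $\theta(z+2\pi)=\theta(z)+2\pi$ for all $z\in\mathbb{R}$ (so that necessarily $k=\frac{2\pi}{L}$). Let the bias-frequency characteristic $\chi\subset(0,\infty)\times(0,\infty)$ be the set of all pairs $(\omega,\gamma)$ for which there is a rotating fluxon wave with bias $\gamma$ and frequency $\omega$. If $$k=\frac{2\pi}{L}>1\qquad\text{and}\qquad \alpha+\beta k^2\ge\sqrt{2}\,k,$$ then $$\chi=\{(\omega,\overline{\gamma}(\omega))\;|\;\omega>0\},$$ where $\overline{\gamma}:[0,\infty)\to[0,\infty)$ is continuous on $[0,\infty)$ and real-analytic on $(0,\infty)$, and satisfies $\overline{\gamma}(0)=0$ and $\lim_{\omega\to+\infty}\overline{\gamma}(\omega)=+\infty$.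 In particular, $\chi$ is connected, and for a given bias $\gamma>0$ the frequencies of rotating fluxon waves are exactly the solutions $\omega\ge 0$ of the equation $\overline{\gamma}(\omega)=\gamma$. -/

import Mathlib

/-- `φ = φ(x,t)` is a classical solution on `ℝ × ℝ` of
`φ_tt + α φ_t + sin φ = φ_xx + β φ_xxt + γ`. -/
def IsJunctionSolution (α β γ : ℝ) (φ : ℝ → ℝ → ℝ) : Prop :=
  ContDiff ℝ 3 (fun p : ℝ × ℝ => φ p.1 p.2) ∧
  ∀ x t : ℝ,
    deriv (deriv (fun s => φ x s)) t + α * deriv (fun s => φ x s) t + Real.sin (φ x t)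
      = deriv (deriv (fun y => φ y t)) x
        + β * deriv (fun s => deriv (deriv (fun y => φ y s)) x) t + γ

/-- `φ` is a rotating fluxon wave with frequency `ω`, for circumference `L`, dissipation
coefficients `α, β` and bias `γ`: it solves the junction equation, satisfies
`φ(x+L,t) = φ(x,t) + 2π`, and has the form `φ(x,t) = θ(kx + ωt)` with
`θ(z+2π) = θ(z) + 2π`. -/
structure IsRotatingFluxonWave (L α β γ ω : ℝ) (φ : ℝ → ℝ → ℝ) : Prop where
  solution : IsJunctionSolution α β γ φ
  annular : ∀ x t : ℝ, φ (x + L) t = φ x t + 2 * Real.pi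
  form : ∃ (k : ℝ) (θ : ℝ → ℝ),
    (∀ z : ℝ, θ (z + 2 * Real.pi) = θ z + 2 * Real.pi) ∧
    ∀ x t : ℝ, φ x t = θ (k * x + ω * t)

/-- The bias-frequency characteristic: all pairs `(ω, γ)` in `(0,∞) × (0,∞)` for which there is
a rotating fluxon wave with bias `γ` and frequency `ω`. -/
def biasFrequencyCharacteristic (L α β : ℝ) : Set (ℝ × ℝ) :=
  {p | 0 < p.1 ∧ 0 < p.2 ∧ ∃ φ : ℝ → ℝ → ℝ, IsRotatingFluxonWave L α β p.2 p.1 φ}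

/-!
Write a rotating wave as `θ(z) = z + u(z)` with `u` of mean zero and period `2π`, which a
translation of `z` achieves, and let `k = 2π / L`. The equation becomes
`-βk²ω u''' + (ω² - k²) u'' + αω u' + sin (z + u) = γ - αω`. Its mean value gives
`γ = αω + mean (sin (z + u))`, so for each `ω` only the equation up to constants has to be solved.

The unknown is `g = u'''` in `L²` of the circle. With `A` the mean-zero antiderivative, the linear
part is `M = -a + b A + c A²`, where `a = βk²ω`, `b = ω² - k²`, `c = αω`. The operator `A` is skew,
and `‖A‖ ≤ 1` by Parseval (`norm_circleInverse_le`, Wirtinger's inequality). Hence `M` is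
invertible for `ω > 0` by Lax–Milgram (`exists_equiv_skewQuadratic`), and
`‖M g‖² ≥ ((a + c)² + b²) ‖A³ g‖²` (`mul_norm_le_norm_skewQuadratic`). The condition
`α + βk² ≥ √2 k` makes the constant at least `ω⁴ + k⁴ ≥ k⁴`, and `k > 1`, while `u ↦ sin (z + u)` is
`1`-Lipschitz in `L²`. So the problem is a contraction with constant `k⁻² < 1` for every `ω > 0`:
the solution exists and is unique (`exists_semilinear`, `eq_of_semilinear`), and the linearization
at it is invertible by a Neumann series. Since `A` maps `L²` to continuous functions, where
`u ↦ sin (z + u)` is analytic, the analytic implicit function theorem shows that `g` and the bias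
depend analytically on `ω` (`analyticAt_semilinear`).

Multiplying the equation by `θ' = 1 + u'` and averaging over a period gives, with normalized `L²`
norms, `γ = αω + βk²ω ‖u''‖² + αω ‖u'‖²` (`IsProfile.profileBias_eq`), so `γ` has the sign of `ω`
and is at least `αω` for `ω > 0`. Multiplying by `u''` gives `|ω² - k²| ‖u''‖ ≤ 1`
(`IsProfile.abs_mul_norm_le`), so `γ = O(ω)` as `ω → 0⁺`.
-/

open Filter Topology MeasureTheory AddCircle

/-! ### Quadratic expressions in a skew contraction -/

section SkewOperator

variable {H : Type*} [NormedAddCommGroup H] [InnerProductSpace ℝ H]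

/-- The operator `-a + b A + c A²`. With `A` the inverse of `d/dz` on mean-zero functions and
`g = u'''`, it sends `g` to `-a u''' + b u'' + c u'`. -/
noncomputable def skewQuadratic (A : H →L[ℝ] H) (a b c : ℝ) : H →L[ℝ] H :=
  -(a • ContinuousLinearMap.id ℝ H) + b • A + c • (A ∘L A)

theorem skewQuadratic_apply (A : H →L[ℝ] H) (a b c : ℝ) (g : H) :
    skewQuadratic A a b c g = -(a • g) + b • A g + c • A (A g) := by
  simp [skewQuadratic]

variable {A : H →L[ℝ] H}

/-- Polarization of `⟪A g, g⟫ = 0`. -/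
theorem inner_skew (hA : ∀ g, inner ℝ (A g) g = 0) (g h : H) :
    inner ℝ (A g) h = -inner ℝ g (A h) := by
  have := hA (g + h)
  rw [map_add, inner_add_left, inner_add_right, inner_add_right, hA, hA,
    real_inner_comm g (A h)] at this
  linarith

theorem inner_skewQuadratic_self (hA : ∀ g, inner ℝ (A g) g = 0) (a b c : ℝ) (g : H) :
    inner ℝ (skewQuadratic A a b c g) g = -(a * ‖g‖ ^ 2 + c * ‖A g‖ ^ 2) := by
  rw [skewQuadratic_apply, inner_add_left, inner_add_left, inner_neg_left, real_inner_smul_left,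
    real_inner_smul_left, real_inner_smul_left, hA, inner_skew hA (A g) g,
    real_inner_self_eq_norm_sq, real_inner_self_eq_norm_sq]
  ring

theorem inner_skewQuadratic_apply (hA : ∀ g, inner ℝ (A g) g = 0) (a b c : ℝ) (g : H) :
    inner ℝ (skewQuadratic A a b c g) (A g) = b * ‖A g‖ ^ 2 := by
  rw [skewQuadratic_apply, inner_add_left, inner_add_left, inner_neg_left, real_inner_smul_left,
    real_inner_smul_left, real_inner_smul_left, hA, real_inner_comm, hA,
    real_inner_self_eq_norm_sq]
  ring

/-- This pairing with `A² g = u'` carries the energy identity for the bias. -/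
theorem inner_skewQuadratic_apply_apply (hA : ∀ g, inner ℝ (A g) g = 0) (a b c : ℝ) (g : H) :
    inner ℝ (skewQuadratic A a b c g) (A (A g)) = a * ‖A g‖ ^ 2 + c * ‖A (A g)‖ ^ 2 := by
  rw [skewQuadratic_apply, inner_add_left, inner_add_left, inner_neg_left, real_inner_smul_left,
    real_inner_smul_left, real_inner_smul_left, real_inner_comm (A (A g)) (A g), hA,
    real_inner_comm, inner_skew hA (A g) g,
    real_inner_self_eq_norm_sq, real_inner_self_eq_norm_sq]
  ring

theorem norm_sq_skewQuadratic (hA : ∀ g, inner ℝ (A g) g = 0) (a b c : ℝ) (g : H) :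
    ‖skewQuadratic A a b c g‖ ^ 2
      = a ^ 2 * ‖g‖ ^ 2 + (b ^ 2 + 2 * a * c) * ‖A g‖ ^ 2 + c ^ 2 * ‖A (A g)‖ ^ 2 := by
  have h : inner ℝ (skewQuadratic A a b c g) (skewQuadratic A a b c g)
      = -(a * inner ℝ (skewQuadratic A a b c g) g)
        + b * inner ℝ (skewQuadratic A a b c g) (A g)
        + c * inner ℝ (skewQuadratic A a b c g) (A (A g)) := by
    conv_lhs => rw [skewQuadratic_apply A a b c g]
    nth_rw 1 [← skewQuadratic_apply A a b c g]
    rw [inner_add_right, inner_add_right, inner_neg_right, real_inner_smul_right,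
      real_inner_smul_right, real_inner_smul_right]
  rw [← real_inner_self_eq_norm_sq, h, inner_skewQuadratic_self hA, inner_skewQuadratic_apply hA,
    inner_skewQuadratic_apply_apply hA]
  ring

/-- For the antiderivative on the circle this says that the Fourier symbol of
`-a u''' + b u'' + c u'` is smallest, over the nonzero modes, at the first one. -/
theorem mul_norm_le_norm_skewQuadratic (hA : ∀ g, inner ℝ (A g) g = 0) (hA1 : ∀ g, ‖A g‖ ≤ ‖g‖)
    {a b c κ : ℝ} (hac : 0 ≤ a * c) (h : κ ^ 2 ≤ (a + c) ^ 2 + b ^ 2) (g : H) :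
    κ * ‖A (A (A g))‖ ≤ ‖skewQuadratic A a b c g‖ := by
  have h1 := hA1 g
  have h2 := hA1 (A g)
  have h3 := hA1 (A (A g))
  refine le_of_sq_le_sq ?_ (norm_nonneg _)
  rw [mul_pow, norm_sq_skewQuadratic hA]
  have s1 : ‖A g‖ ^ 2 ≤ ‖g‖ ^ 2 := by gcongr
  have s2 : ‖A (A g)‖ ^ 2 ≤ ‖A g‖ ^ 2 := by gcongr
  have s3 : ‖A (A (A g))‖ ^ 2 ≤ ‖A (A g)‖ ^ 2 := by gcongr
  calc κ ^ 2 * ‖A (A (A g))‖ ^ 2 ≤ ((a + c) ^ 2 + b ^ 2) * ‖A (A g)‖ ^ 2 := by gcongr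
    _ = a ^ 2 * ‖A (A g)‖ ^ 2 + (b ^ 2 + 2 * (a * c)) * ‖A (A g)‖ ^ 2
        + c ^ 2 * ‖A (A g)‖ ^ 2 := by ring
    _ ≤ a ^ 2 * ‖g‖ ^ 2 + (b ^ 2 + 2 * (a * c)) * ‖A g‖ ^ 2 + c ^ 2 * ‖A (A g)‖ ^ 2 := by
        gcongr
        exact h2.trans h1
    _ = _ := by ring

theorem exists_equiv_skewQuadratic [CompleteSpace H] (hA : ∀ g, inner ℝ (A g) g = 0) {a c : ℝ}
    (ha : 0 < a) (b : ℝ) (hc : 0 ≤ c) :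
    ∃ e : H ≃L[ℝ] H, (e : H →L[ℝ] H) = skewQuadratic A a b c := by
  -- Lax–Milgram for `-M`, whose quadratic form is `a ‖g‖² + c ‖A g‖²`
  let B : H →L[ℝ] H →L[ℝ] ℝ := (innerSL ℝ).comp (-skewQuadratic A a b c)
  have hB : IsCoercive B := by
    refine ⟨a, ha, fun g ↦ ?_⟩
    have : B g g = a * ‖g‖ ^ 2 + c * ‖A g‖ ^ 2 := by
      have := inner_skewQuadratic_self hA a b c g
      simp only [B, ContinuousLinearMap.comp_apply, neg_apply,
        innerSL_apply_apply, inner_neg_left, this, neg_neg]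
    rw [this]
    nlinarith [mul_nonneg hc (sq_nonneg ‖A g‖)]
  refine ⟨hB.continuousLinearEquivOfBilin.trans (ContinuousLinearEquiv.neg ℝ), ?_⟩
  ext1 g
  have : -skewQuadratic A a b c g = hB.continuousLinearEquivOfBilin g :=
    hB.unique_continuousLinearEquivOfBilin fun w ↦ by simp [B]
  simp [← this]

end SkewOperator

/-! ### Semilinear equations whose nonlinearity is nonexpansive in a weak norm -/

section Semilinear

variable {H E : Type*} [NormedAddCommGroup H] [InnerProductSpace ℝ H]
  [NormedAddCommGroup E] [NormedSpace ℝ E]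
  {ι : E →L[ℝ] H} {J : H →L[ℝ] E} {S : E → E} {P : H →L[ℝ] H}

/-- Uniqueness for `M g + P ι S(J g) = 0`, when `M` dominates `ι J` with a factor `κ > 1` and `S` is
nonexpansive in the weak norm `‖ι ·‖`. The map `S` need not be Lipschitz in the norm of `E`. -/
theorem eq_of_semilinear {M : H →L[ℝ] H} (hM : Function.Injective M) {κ : ℝ} (hκ : 1 < κ)
    (hMJ : ∀ g, κ * ‖ι (J g)‖ ≤ ‖M g‖) (hP : ∀ h, ‖P h‖ ≤ ‖h‖)
    (hS : ∀ u v, ‖ι (S u - S v)‖ ≤ ‖ι (u - v)‖) {g h : H}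
    (hg : M g + P (ι (S (J g))) = 0) (hh : M h + P (ι (S (J h))) = 0) : g = h := by
  have e : M (g - h) = -P (ι (S (J g) - S (J h))) := by
    rw [map_sub, map_sub, map_sub, eq_neg_of_add_eq_zero_left hg, eq_neg_of_add_eq_zero_left hh]
    abel
  have h1 : κ * ‖ι (J (g - h))‖ ≤ ‖ι (J (g - h))‖ := calc
    _ ≤ ‖M (g - h)‖ := hMJ _
    _ ≤ ‖ι (S (J g) - S (J h))‖ := by rw [e, norm_neg]; exact hP _
    _ ≤ ‖ι (J (g - h))‖ := by rw [map_sub J]; exact hS _ _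
  have h2 : ‖ι (J (g - h))‖ = 0 := by nlinarith [norm_nonneg (ι (J (g - h)))]
  have h3 : ‖ι (S (J g) - S (J h))‖ ≤ 0 := by rw [← h2, map_sub J]; exact hS _ _
  rw [norm_le_zero_iff.1 h3, map_zero, neg_zero] at e
  exact sub_eq_zero.1 (hM (by rw [e, map_zero]))

/-- Existence for the equation of `eq_of_semilinear`, by the contraction principle in `H`. -/
theorem exists_semilinear [CompleteSpace H] (M : H ≃L[ℝ] H) {κ : ℝ} (hκ : 1 < κ)
    (hMJ : ∀ g, κ * ‖ι (J g)‖ ≤ ‖M g‖) (hP : ∀ h, ‖P h‖ ≤ ‖h‖)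
    (hS : ∀ u v, ‖ι (S u - S v)‖ ≤ ‖ι (u - v)‖) : ∃ g : H, M g + P (ι (S (J g))) = 0 := by
  -- the unknown of the contraction is `f = ι (S (J g))`, with `M g = -P f`
  let Φ : H → H := fun f ↦ ι (S (J (M.symm (-P f))))
  have hΦ : ContractingWith (κ⁻¹).toNNReal Φ := by
    have hκ0 : 0 < κ := by linarith
    refine ⟨Real.toNNReal_lt_one.2 (inv_lt_one_of_one_lt₀ hκ), LipschitzWith.of_dist_le_mul
      fun f f' ↦ ?_⟩
    rw [Real.coe_toNNReal _ (by positivity), dist_eq_norm, dist_eq_norm, ← map_sub]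
    refine (hS _ _).trans ?_
    rw [← map_sub, ← map_sub, inv_mul_eq_div, le_div_iff₀' hκ0]
    refine (hMJ _).trans ?_
    rw [M.apply_symm_apply, neg_sub_neg, ← map_sub]
    exact (hP _).trans (norm_sub_rev _ _).le
  refine ⟨M.symm (-P (hΦ.fixedPoint)), ?_⟩
  have := hΦ.fixedPoint_isFixedPt
  simp only [Function.IsFixedPt, Φ] at this
  rw [this, M.apply_symm_apply, neg_add_cancel]

/-- A weak-norm Lipschitz bound passes to the derivative, although the derivative is taken in the
stronger norm of `E`. -/
theorem norm_fderiv_le_of_weak_lipschitz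
    (hS : ∀ u v, ‖ι (S u - S v)‖ ≤ ‖ι (u - v)‖) {S' : E →L[ℝ] E} {u : E}
    (hS' : HasFDerivAt S S' u) (h : E) : ‖ι (S' h)‖ ≤ ‖ι h‖ := by
  have h1 : HasDerivAt (fun t : ℝ ↦ u + t • h) h 0 := by
    simpa using ((hasDerivAt_id (0 : ℝ)).smul_const h).const_add u
  have h2 : HasDerivAt (fun t : ℝ ↦ ι (S (u + t • h))) (ι (S' h)) 0 := by
    refine ι.hasFDerivAt.comp_hasDerivAt _ (HasFDerivAt.comp_hasDerivAt (0 : ℝ) ?_ h1)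
    simpa using hS'
  have := h2.le_of_lip' (norm_nonneg (ι h)) (Eventually.of_forall fun t ↦ by
    rw [← map_sub]
    refine (hS _ _).trans ?_
    simp [norm_smul, mul_comm])
  simpa using this

open scoped ContDiff in
/-- Solutions of the equation of `eq_of_semilinear` depend analytically on a parameter in `M`: an
implicit function exists near each solution and coincides with `g` by uniqueness. -/
theorem analyticAt_semilinear [CompleteSpace H] [CompleteSpace E]
    {M : ℝ → H →L[ℝ] H} {g : ℝ → H} {κ t : ℝ} (hκ : 1 < κ)
    (hM : ∀ᶠ s in 𝓝 t, Function.Injective (M s) ∧ ∀ g, κ * ‖ι (J g)‖ ≤ ‖M s g‖)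
    (e : H ≃L[ℝ] H) (he : (e : H →L[ℝ] H) = M t) (hMan : ContDiff ℝ ω M)
    (hP : ∀ h, ‖P h‖ ≤ ‖h‖) (hS : ∀ u v, ‖ι (S u - S v)‖ ≤ ‖ι (u - v)‖)
    (hSan : ContDiff ℝ ω S) (hg : ∀ᶠ s in 𝓝 t, M s (g s) + P (ι (S (J (g s)))) = 0) :
    AnalyticAt ℝ g t := by
  let G : ℝ × H → H := fun p ↦ M p.1 p.2 + P (ι (S (J p.2)))
  have hG : ContDiffAt ℝ ω G (t, g t) := by
    refine ContDiff.contDiffAt ?_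
    fun_prop
  set S' := fderiv ℝ S (J (g t))
  have hS' : HasFDerivAt S S' (J (g t)) :=
    (hSan.differentiable (by simp)).differentiableAt.hasFDerivAt
  have hder : HasFDerivAt (fun h ↦ G (t, h)) (M t + P ∘L ι ∘L S' ∘L J) (g t) :=
    (M t).hasFDerivAt.add (P.hasFDerivAt.comp _ (ι.hasFDerivAt.comp _
      (HasFDerivAt.comp _ hS' J.hasFDerivAt)))
  have hpart : fderiv ℝ G (t, g t) ∘L .inr ℝ ℝ H = M t + P ∘L ι ∘L S' ∘L J := by
    refine HasFDerivAt.unique ?_ hder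
    exact HasFDerivAt.comp (g t) (hG.differentiableAt (by simp)).hasFDerivAt
      (hasFDerivAt_prodMk_right t (g t))
  have hinv : (fderiv ℝ G (t, g t) ∘L .inr ℝ ℝ H).IsInvertible := by
    -- `M + B = (1 + B M⁻¹) M` with `‖B M⁻¹‖ ≤ κ⁻¹ < 1`
    rw [hpart]
    set N : H →L[ℝ] H := -((P ∘L ι ∘L S' ∘L J) ∘L (e.symm : H →L[ℝ] H)) with hN
    have hN1 : ‖N‖ < 1 := by
      refine lt_of_le_of_lt (ContinuousLinearMap.opNorm_le_bound _
        (inv_nonneg.2 (by linarith : (0 : ℝ) ≤ κ)) fun h ↦ ?_) (inv_lt_one_of_one_lt₀ hκ)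
      rw [inv_mul_eq_div, le_div_iff₀' (by linarith)]
      have h1 := hM.self_of_nhds.2 (e.symm h)
      rw [← he, ContinuousLinearEquiv.coe_coe, e.apply_symm_apply] at h1
      refine le_trans ?_ h1
      gcongr
      simp only [hN, neg_apply, norm_neg, ContinuousLinearMap.comp_apply,
        ContinuousLinearEquiv.coe_coe]
      exact (hP _).trans (norm_fderiv_le_of_weak_lipschitz hS hS' _)
    let U := ContinuousLinearEquiv.unitsEquiv ℝ H (Units.oneSub N hN1)
    refine ⟨e.trans U, ?_⟩
    ext1 h
    simp [U, hN, ← he]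
  have hi := hG.contDiffAt_implicitFunction (by simp) hinv
  refine AnalyticAt.congr hi.analyticAt ?_
  have h0 : G (t, g t) = 0 := hg.self_of_nhds
  filter_upwards [hG.eventually_apply_implicitFunction (by simp) hinv, hM, hg] with s hs1 hs2 hs3
  rw [h0] at hs1
  exact eq_of_semilinear hs2.1 hκ hs2.2 hP hS hs1 hs3

end Semilinear

/-! ### Mean-zero antiderivatives on the circle -/

/-- The circle `ℝ / 2πℤ`. -/
abbrev PhaseCircle : Type := AddCircle (2 * Real.pi)

instance fact_two_pi_pos : Fact (0 < 2 * Real.pi) := ⟨Real.two_pi_pos⟩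

/-- Real `L²` functions on the circle, for the Haar probability measure. -/
abbrev CircleL2 : Type := Lp ℝ 2 (haarAddCircle (T := 2 * Real.pi))

/-- The embedding of continuous functions into `L²`. -/
noncomputable abbrev toCircleL2 : C(PhaseCircle, ℝ) →L[ℝ] CircleL2 :=
  ContinuousMap.toLp 2 haarAddCircle ℝ

/-- The mean value of a continuous function on the circle. -/
noncomputable def circleMean (f : C(PhaseCircle, ℝ)) : ℝ :=
  ∫ x, f x ∂haarAddCircle

theorem integrable_circle (f : C(PhaseCircle, ℝ)) :
    Integrable (fun x ↦ f x) (haarAddCircle (T := 2 * Real.pi)) :=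
  f.continuous.integrable_of_hasCompactSupport (HasCompactSupport.of_compactSpace _)

theorem circleMean_eq_intervalIntegral (f : C(PhaseCircle, ℝ)) :
    circleMean f = (2 * Real.pi)⁻¹ * ∫ x in (0 : ℝ)..2 * Real.pi, f (x : PhaseCircle) := by
  have := AddCircle.intervalIntegral_preimage (2 * Real.pi) 0 (fun x ↦ f x)
  rw [zero_add] at this
  rw [circleMean, integral_haarAddCircle, this, smul_eq_mul]

theorem circleMean_add (f g : C(PhaseCircle, ℝ)) :
    circleMean (f + g) = circleMean f + circleMean g :=
  integral_add (integrable_circle f) (integrable_circle g)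

theorem circleMean_smul (r : ℝ) (f : C(PhaseCircle, ℝ)) :
    circleMean (r • f) = r * circleMean f :=
  integral_const_mul r _

theorem circleMean_one : circleMean 1 = 1 := by simp [circleMean]

theorem inner_toCircleL2 (f g : C(PhaseCircle, ℝ)) :
    inner ℝ (toCircleL2 f) (toCircleL2 g) = circleMean (f * g) := by
  rw [ContinuousMap.inner_toLp]
  simp [circleMean, mul_comm]

theorem norm_sq_toCircleL2 (f : C(PhaseCircle, ℝ)) :
    ‖toCircleL2 f‖ ^ 2 = circleMean (f * f) := by
  rw [← real_inner_self_eq_norm_sq, inner_toCircleL2]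

theorem norm_toCircleL2_one : ‖toCircleL2 1‖ = 1 := by
  have := norm_sq_toCircleL2 1
  rw [one_mul, circleMean_one] at this
  nlinarith [norm_nonneg (toCircleL2 1)]

theorem circleMean_eq_inner (f : C(PhaseCircle, ℝ)) :
    circleMean f = inner ℝ (toCircleL2 1) (toCircleL2 f) := by
  rw [inner_toCircleL2, one_mul]

theorem circleMean_mono {f g : C(PhaseCircle, ℝ)} (h : ∀ x, f x ≤ g x) :
    circleMean f ≤ circleMean g :=
  integral_mono (integrable_circle f) (integrable_circle g) h

theorem norm_toCircleL2_mono {f g : C(PhaseCircle, ℝ)} (h : ∀ x, |f x| ≤ |g x|) :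
    ‖toCircleL2 f‖ ≤ ‖toCircleL2 g‖ := by
  refine le_of_sq_le_sq ?_ (norm_nonneg _)
  rw [norm_sq_toCircleL2, norm_sq_toCircleL2]
  exact circleMean_mono fun x ↦ by
    simpa only [ContinuousMap.mul_apply] using abs_le_iff_mul_self_le.1 (h x)

/-- The integral of a derivative over a period vanishes. -/
theorem circleMean_eq_zero_of_hasDerivAt {U f : C(PhaseCircle, ℝ)}
    (h : ∀ x : ℝ, HasDerivAt (fun s : ℝ ↦ U (s : PhaseCircle)) (f (x : PhaseCircle)) x) :
    circleMean f = 0 := by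
  have hc : Continuous fun x : ℝ ↦ f (x : PhaseCircle) :=
    f.continuous.comp (AddCircle.continuous_mk' _)
  rw [circleMean_eq_intervalIntegral,
    intervalIntegral.integral_eq_sub_of_hasDerivAt (fun x _ ↦ h x) (hc.intervalIntegrable _ _)]
  have : ((2 * Real.pi : ℝ) : PhaseCircle) = ((0 : ℝ) : PhaseCircle) := by
    simp
  rw [this, sub_self, mul_zero]

/-- A continuous `2π`-periodic function on the line, as a function on the circle. -/
noncomputable def circleLift (f : ℝ → ℝ) (hf : Continuous f)
    (hp : Function.Periodic f (2 * Real.pi)) : C(PhaseCircle, ℝ) :=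
  ⟨hp.lift, continuous_coinduced_dom.2 hf⟩

@[simp] theorem circleLift_coe (f : ℝ → ℝ) (hf : Continuous f)
    (hp : Function.Periodic f (2 * Real.pi)) (x : ℝ) :
    circleLift f hf hp (x : PhaseCircle) = f x := rfl

theorem circle_ext {f g : C(PhaseCircle, ℝ)} (h : ∀ x : ℝ, f (x : PhaseCircle) = g x) :
    f = g := by
  ext x
  induction x using QuotientAddGroup.induction_on with
  | H x => exact h x

theorem eq_of_hasDerivAt_of_mean {U V f : C(PhaseCircle, ℝ)}
    (hU : ∀ x : ℝ, HasDerivAt (fun s : ℝ ↦ U (s : PhaseCircle)) (f (x : PhaseCircle)) x)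
    (hV : ∀ x : ℝ, HasDerivAt (fun s : ℝ ↦ V (s : PhaseCircle)) (f (x : PhaseCircle)) x)
    (h : circleMean U = circleMean V) : U = V := by
  have hd : ∀ x : ℝ, HasDerivAt (fun s : ℝ ↦ U (s : PhaseCircle) - V (s : PhaseCircle)) 0 x :=
    fun x ↦ by
    convert! (hU x).sub (hV x) using 1; rw [sub_self]
  have hc : ∀ x : ℝ, U (x : PhaseCircle) - V (x : PhaseCircle)
      = U ((0 : ℝ) : PhaseCircle) - V ((0 : ℝ) : PhaseCircle) := fun x ↦
    is_const_of_deriv_eq_zero (fun x ↦ (hd x).differentiableAt) (fun x ↦ (hd x).deriv) x 0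
  set C := U ((0 : ℝ) : PhaseCircle) - V ((0 : ℝ) : PhaseCircle)
  have hUV : U = V + C • 1 := circle_ext fun x ↦ by
    simp only [ContinuousMap.add_apply, ContinuousMap.smul_apply, ContinuousMap.one_apply]
    rw [← hc x]; simp
  rw [hUV, circleMean_add, circleMean_smul, circleMean_one] at h
  have hC : C = 0 := by linarith
  rw [hUV, hC, zero_smul, add_zero]

theorem exists_antiderivative (f : C(PhaseCircle, ℝ)) : ∃ U : C(PhaseCircle, ℝ),
    (∀ x : ℝ, HasDerivAt (fun s : ℝ ↦ U (s : PhaseCircle))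
      (f (x : PhaseCircle) - circleMean f) x) ∧ circleMean U = 0 := by
  let φ : ℝ → ℝ := fun x ↦ f (x : PhaseCircle) - circleMean f
  have hφ : Continuous φ := (f.continuous.comp (AddCircle.continuous_mk' _)).sub continuous_const
  have hφp : Function.Periodic φ (2 * Real.pi) := fun x ↦ by simp [φ]
  have hd : ∀ x, HasDerivAt (fun y ↦ ∫ s in (0 : ℝ)..y, φ s) (φ x) x := fun x ↦
    intervalIntegral.integral_hasDerivAt_right (hφ.intervalIntegrable _ _)
      hφ.stronglyMeasurable.stronglyMeasurableAtFilter hφ.continuousAt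
  have h0 : ∫ s in (0 : ℝ)..2 * Real.pi, φ s = 0 := by
    have hc : Continuous fun x : ℝ ↦ f (x : PhaseCircle) :=
      f.continuous.comp (AddCircle.continuous_mk' _)
    rw [intervalIntegral.integral_sub (hc.intervalIntegrable _ _) (by simp),
      circleMean_eq_intervalIntegral]
    simp only [intervalIntegral.integral_const, sub_zero, smul_eq_mul]
    field_simp
    ring
  have hp : Function.Periodic (fun y ↦ ∫ s in (0 : ℝ)..y, φ s) (2 * Real.pi) := fun x ↦ by
    have h1 := hφp.intervalIntegral_add_eq x 0
    rw [zero_add, h0] at h1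
    change ∫ s in (0 : ℝ)..(x + 2 * Real.pi), φ s = _
    rw [← intervalIntegral.integral_add_adjacent_intervals (hφ.intervalIntegrable 0 x)
      (hφ.intervalIntegrable x _), h1, add_zero]
  let U := circleLift _ (continuous_iff_continuousAt.2 fun x ↦ (hd x).continuousAt) hp
  refine ⟨U + (-circleMean U) • 1, fun x ↦ ?_, ?_⟩
  · simpa [U] using (hd x).add_const (-circleMean U)
  · rw [circleMean_add, circleMean_smul, circleMean_one]; ring

/-- The antiderivative of mean zero of `f - circleMean f`. -/
noncomputable def antiderivative (f : C(PhaseCircle, ℝ)) : C(PhaseCircle, ℝ) :=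
  (exists_antiderivative f).choose

theorem hasDerivAt_antiderivative (f : C(PhaseCircle, ℝ)) (x : ℝ) :
    HasDerivAt (fun s : ℝ ↦ antiderivative f (s : PhaseCircle))
      (f (x : PhaseCircle) - circleMean f) x :=
  (exists_antiderivative f).choose_spec.1 x

theorem circleMean_antiderivative (f : C(PhaseCircle, ℝ)) : circleMean (antiderivative f) = 0 :=
  (exists_antiderivative f).choose_spec.2

theorem antiderivative_eq {U f : C(PhaseCircle, ℝ)}
    (hU : ∀ x : ℝ, HasDerivAt (fun s : ℝ ↦ U (s : PhaseCircle))
      (f (x : PhaseCircle) - circleMean f) x)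
    (h : circleMean U = 0) : antiderivative f = U := by
  have e : ∀ x : ℝ, f (x : PhaseCircle) - circleMean f
      = (f + (-circleMean f) • (1 : C(PhaseCircle, ℝ))) (x : PhaseCircle) := fun x ↦ by
    simp [sub_eq_add_neg]
  refine eq_of_hasDerivAt_of_mean (f := f + (-circleMean f) • (1 : C(PhaseCircle, ℝ)))
    (fun x ↦ ?_) (fun x ↦ ?_) ?_
  · rw [← e]; exact hasDerivAt_antiderivative f x
  · rw [← e]; exact hU x
  · rw [h, circleMean_antiderivative]

/-- `antiderivative` as a linear map. -/
noncomputable def antiderivativeₗ : C(PhaseCircle, ℝ) →ₗ[ℝ] C(PhaseCircle, ℝ) where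
  toFun := antiderivative
  map_add' f g := by
    refine antiderivative_eq (fun x ↦ ?_) ?_
    · rw [circleMean_add]
      convert! (hasDerivAt_antiderivative f x).add (hasDerivAt_antiderivative g x) using 1
      simp only [ContinuousMap.add_apply]; ring
    · rw [circleMean_add, circleMean_antiderivative, circleMean_antiderivative, add_zero]
  map_smul' r f := by
    refine antiderivative_eq (fun x ↦ ?_) ?_
    · rw [circleMean_smul]
      convert! (hasDerivAt_antiderivative f x).const_mul r using 1
      simp only [ContinuousMap.smul_apply, smul_eq_mul]; ring
    · simp only [RingHom.id_apply, circleMean_smul, circleMean_antiderivative, mul_zero]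

theorem abs_circleMean_le (f : C(PhaseCircle, ℝ)) : |circleMean f| ≤ ‖toCircleL2 f‖ := by
  have := abs_real_inner_le_norm (toCircleL2 1) (toCircleL2 f)
  rwa [norm_toCircleL2_one, one_mul, ← circleMean_eq_inner] at this

/-- The antiderivative gains regularity: its sup norm is controlled by the `L²` norm of `f`, which
allows its extension to `L²` with continuous values. -/
theorem norm_antiderivative_le (f : C(PhaseCircle, ℝ)) :
    ‖antiderivative f‖ ≤ 8 * Real.pi * ‖toCircleL2 f‖ := by
  set U := antiderivative f
  have hc : Continuous fun x : ℝ ↦ f (x : PhaseCircle) :=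
    f.continuous.comp (AddCircle.continuous_mk' _)
  have hc2 : Continuous fun x : ℝ ↦ |f (x : PhaseCircle) - circleMean f| :=
    (hc.sub continuous_const).abs
  set N := ‖toCircleL2 f‖
  have habs : circleMean ⟨fun x ↦ |f x - circleMean f|, by fun_prop⟩ ≤ 2 * N := by
    have h1 : circleMean ⟨fun x ↦ |f x - circleMean f|, by fun_prop⟩
        ≤ circleMean ((⟨fun x ↦ |f x|, by fun_prop⟩ : C(PhaseCircle, ℝ))
          + |circleMean f| • (1 : C(PhaseCircle, ℝ))) :=
      circleMean_mono fun x ↦ by simpa using abs_sub (f x) (circleMean f)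
    have h2 : circleMean ⟨fun x ↦ |f x|, by fun_prop⟩ ≤ N :=
      (le_abs_self _).trans ((abs_circleMean_le _).trans
        (norm_toCircleL2_mono fun x ↦ by simp))
    rw [circleMean_add, circleMean_smul, circleMean_one] at h1
    linarith [abs_circleMean_le f]
  have hosc : ∀ x ∈ Set.Icc 0 (2 * Real.pi), |U ((x : ℝ) : PhaseCircle) - U ((0 : ℝ) : PhaseCircle)|
      ≤ 2 * Real.pi * (2 * N) := by
    intro x hx
    rw [← intervalIntegral.integral_eq_sub_of_hasDerivAt
      (fun y _ ↦ hasDerivAt_antiderivative f y)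
      ((hc.sub continuous_const).intervalIntegrable _ _)]
    calc |∫ y in (0 : ℝ)..x, (f (y : PhaseCircle) - circleMean f)|
        ≤ ∫ y in (0 : ℝ)..x, |f (y : PhaseCircle) - circleMean f| :=
          intervalIntegral.abs_integral_le_integral_abs hx.1
      _ ≤ ∫ y in (0 : ℝ)..2 * Real.pi, |f (y : PhaseCircle) - circleMean f| :=
          intervalIntegral.integral_mono_interval le_rfl hx.1 hx.2
            (Eventually.of_forall fun _ ↦ abs_nonneg _) (hc2.intervalIntegrable _ _)
      _ = 2 * Real.pi * circleMean ⟨fun x ↦ |f x - circleMean f|, by fun_prop⟩ := by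
          rw [circleMean_eq_intervalIntegral ⟨fun x ↦ |f x - circleMean f|, by fun_prop⟩,
            mul_inv_cancel_left₀ Real.two_pi_pos.ne']
          rfl
      _ ≤ _ := by gcongr
  set U₀ := U ((0 : ℝ) : PhaseCircle) with hU₀
  have hosc' : ∀ x : PhaseCircle, |U x - U₀| ≤ 4 * Real.pi * N := by
    intro x
    obtain ⟨y, hy, rfl⟩ : x ∈ ((↑) : ℝ → PhaseCircle) '' Set.Icc 0 (0 + 2 * Real.pi) := by
      rw [AddCircle.coe_image_Icc_eq]; trivial
    rw [zero_add] at hy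
    linarith [hosc y hy]
  have hmean : |U₀| ≤ 4 * Real.pi * N := by
    have h0 : circleMean (U + (-U₀) • (1 : C(PhaseCircle, ℝ))) = -U₀ := by
      rw [circleMean_add, circleMean_smul, circleMean_one, circleMean_antiderivative]; ring
    rw [← abs_neg, ← h0]
    have := norm_integral_le_of_norm_le_const (μ := haarAddCircle (T := 2 * Real.pi))
      (f := ⇑(U + (-U₀) • (1 : C(PhaseCircle, ℝ)))) (C := 4 * Real.pi * N)
      (Eventually.of_forall fun x ↦ by simpa [sub_eq_add_neg] using hosc' x)
    simpa only [probReal_univ, mul_one] using! this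
  refine (ContinuousMap.norm_le _ (by positivity)).2 fun x ↦ ?_
  rw [Real.norm_eq_abs]
  have := abs_add_le (U x - U₀) U₀
  rw [sub_add_cancel] at this
  linarith [hosc' x]

/-- Wirtinger's inequality: by Parseval, since differentiation multiplies the `n`-th Fourier
coefficient by `i n`. -/
theorem integral_norm_sq_le_of_hasDerivAt {V V' : ℝ → ℂ} (hV : ∀ x, HasDerivAt V (V' x) x)
    (hV' : Continuous V') (hper : V (2 * Real.pi) = V 0)
    (h0 : ∫ x in (0 : ℝ)..2 * Real.pi, V x = 0) :
    ∫ x in (0 : ℝ)..2 * Real.pi, ‖V x‖ ^ 2 ≤ ∫ x in (0 : ℝ)..2 * Real.pi, ‖V' x‖ ^ 2 := by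
  have hVc : Continuous V := continuous_iff_continuousAt.2 fun x ↦ (hV x).continuousAt
  have hL2 : ∀ {f : ℝ → ℂ}, Continuous f →
      MemLp f 2 (volume.restrict (Set.Ioc 0 (2 * Real.pi))) := fun {f} hf ↦ by
    obtain ⟨C, hC⟩ := isCompact_Icc.exists_bound_of_continuousOn (s := Set.Icc 0 (2 * Real.pi))
      hf.continuousOn
    refine MemLp.of_bound hf.aestronglyMeasurable C ?_
    filter_upwards [ae_restrict_mem measurableSet_Ioc] with x hx
    exact hC x ⟨hx.1.le, hx.2⟩
  have h1 := hasSum_sq_fourierCoeffOn Real.two_pi_pos (hL2 hVc)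
  have h2 := hasSum_sq_fourierCoeffOn Real.two_pi_pos (hL2 hV')
  have h3 := hasSum_le (fun n ↦ ?_) h1 h2
  · rw [sub_zero, smul_eq_mul, smul_eq_mul] at h3
    exact le_of_mul_le_mul_left h3 (by positivity)
  by_cases hn : n = 0
  · subst hn
    rw [fourierCoeffOn_eq_integral]
    simp only [neg_zero, fourier_zero, one_smul, h0, smul_zero, norm_zero]
    rw [zero_pow two_ne_zero]
    positivity
  · rw [fourierCoeffOn_of_hasDerivAt Real.two_pi_pos hn (fun x _ ↦ hV x)
      (hV'.intervalIntegrable _ _), hper, sub_self, mul_zero, zero_sub]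
    have h1n : (1 : ℝ) ≤ |(n : ℝ)| := by exact_mod_cast Int.one_le_abs hn
    have : ‖1 / (-2 * (Real.pi : ℂ) * Complex.I * n) *
        -(((2 * Real.pi : ℝ) - (0 : ℝ) : ℂ) * fourierCoeffOn Real.two_pi_pos V' n)‖
        = |(n : ℝ)|⁻¹ * ‖fourierCoeffOn Real.two_pi_pos V' n‖ := by
      simp [abs_of_pos Real.pi_pos]
      field_simp
    rw [this]
    gcongr
    exact mul_le_of_le_one_left (norm_nonneg _) (inv_le_one_of_one_le₀ h1n)

theorem norm_toCircleL2_antiderivative_le (f : C(PhaseCircle, ℝ)) :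
    ‖toCircleL2 (antiderivative f)‖ ≤ ‖toCircleL2 f‖ := by
  set U := antiderivative f
  set f₀ := f + (-circleMean f) • (1 : C(PhaseCircle, ℝ)) with hf₀
  have hf₀x : ∀ x, f₀ x = f x - circleMean f := fun x ↦ by simp [hf₀, sub_eq_add_neg]
  have hsq : ∀ g : C(PhaseCircle, ℝ), ‖toCircleL2 g‖ ^ 2
      = (2 * Real.pi)⁻¹ * ∫ x in (0 : ℝ)..2 * Real.pi, ‖((g (x : PhaseCircle) : ℝ) : ℂ)‖ ^ 2 :=
    fun g ↦ by
      rw [norm_sq_toCircleL2, circleMean_eq_intervalIntegral]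
      simp [sq]
  have h1 : ‖toCircleL2 U‖ ^ 2 ≤ ‖toCircleL2 f₀‖ ^ 2 := by
    rw [hsq, hsq]
    refine mul_le_mul_of_nonneg_left (integral_norm_sq_le_of_hasDerivAt (fun x ↦ ?_) ?_ ?_ ?_)
      (by positivity)
    · rw [hf₀x]
      exact (hasDerivAt_antiderivative f x).ofReal_comp
    · exact Complex.continuous_ofReal.comp (f₀.continuous.comp (AddCircle.continuous_mk' _))
    · rw [AddCircle.coe_period]; rfl
    · have := circleMean_antiderivative f
      rw [circleMean_eq_intervalIntegral, mul_eq_zero] at this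
      rw [intervalIntegral.integral_ofReal, this.resolve_left (by positivity), Complex.ofReal_zero]
  have h2 : ‖toCircleL2 f₀‖ ^ 2 = ‖toCircleL2 f‖ ^ 2 - circleMean f ^ 2 := by
    have h3 := norm_add_sq_real (toCircleL2 f) ((-circleMean f) • toCircleL2 1)
    rw [← map_smul, ← map_add, map_smul, real_inner_smul_right, real_inner_comm,
      ← circleMean_eq_inner, norm_smul, norm_toCircleL2_one, mul_one, Real.norm_eq_abs,
      sq_abs] at h3
    rw [h3]; ring
  refine le_of_sq_le_sq ?_ (norm_nonneg _)
  nlinarith [sq_nonneg (circleMean f)]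

theorem denseRange_toCircleL2 : DenseRange toCircleL2 :=
  ContinuousMap.toLp_denseRange ℝ haarAddCircle ℝ (by simp)

/-- The extension of `antiderivative` to `L²`, with values in the continuous functions. -/
noncomputable def antiderivativeL2 : CircleL2 →L[ℝ] C(PhaseCircle, ℝ) :=
  antiderivativeₗ.extendOfNorm (toCircleL2 : C(PhaseCircle, ℝ) →ₗ[ℝ] CircleL2)

@[simp] theorem antiderivativeL2_toCircleL2 (f : C(PhaseCircle, ℝ)) :
    antiderivativeL2 (toCircleL2 f) = antiderivative f :=
  LinearMap.extendOfNorm_eq denseRange_toCircleL2 ⟨_, norm_antiderivative_le⟩ f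

/-- `antiderivative` as a bounded operator on `L²`. -/
noncomputable def circleInverse : CircleL2 →L[ℝ] CircleL2 :=
  toCircleL2 ∘L antiderivativeL2

theorem circleInverse_apply (g : CircleL2) :
    circleInverse g = toCircleL2 (antiderivativeL2 g) := rfl

theorem norm_circleInverse_le (g : CircleL2) : ‖circleInverse g‖ ≤ ‖g‖ := by
  refine denseRange_toCircleL2.induction_on g
    (isClosed_le (by fun_prop) (by fun_prop)) fun f ↦ ?_
  rw [circleInverse_apply, antiderivativeL2_toCircleL2]
  exact norm_toCircleL2_antiderivative_le f

theorem inner_one_circleInverse (g : CircleL2) :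
    inner ℝ (toCircleL2 1) (circleInverse g) = 0 := by
  refine denseRange_toCircleL2.induction_on g
    (isClosed_eq (by fun_prop) (by fun_prop)) fun f ↦ ?_
  rw [circleInverse_apply, antiderivativeL2_toCircleL2, ← circleMean_eq_inner,
    circleMean_antiderivative]

/-- The antiderivative is skew: for continuous `f` this is `∫ U U' = 0` over a period. -/
theorem inner_circleInverse_self (g : CircleL2) : inner ℝ (circleInverse g) g = 0 := by
  refine denseRange_toCircleL2.induction_on g
    (isClosed_eq (by fun_prop) (by fun_prop)) fun f ↦ ?_
  rw [circleInverse_apply, antiderivativeL2_toCircleL2, inner_toCircleL2]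
  set U := antiderivative f
  -- `U f = (U² / 2)' + (circleMean f) U`
  have h : circleMean (U * f + (-circleMean f) • U) = 0 := by
    refine circleMean_eq_zero_of_hasDerivAt (U := (1 / 2 : ℝ) • (U * U)) fun x ↦ ?_
    have hU := hasDerivAt_antiderivative f x
    convert! (hU.mul hU).const_mul (1 / 2 : ℝ) using 1
    simp only [ContinuousMap.add_apply, ContinuousMap.mul_apply, ContinuousMap.smul_apply,
      smul_eq_mul, U]
    ring
  rwa [circleMean_add, circleMean_smul, circleMean_antiderivative, mul_zero, add_zero] at h

/-! ### The sine nonlinearity -/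

/-- The map `u ↦ iu` from real to complex continuous functions on the circle. -/
noncomputable def circleMulI : C(PhaseCircle, ℝ) →L[ℝ] C(PhaseCircle, ℂ) :=
  (ContinuousLinearMap.toSpanSingleton ℝ Complex.I).compLeftContinuous ℝ PhaseCircle

/-- The imaginary part, on continuous functions on the circle. -/
noncomputable def circleIm : C(PhaseCircle, ℂ) →L[ℝ] C(PhaseCircle, ℝ) :=
  Complex.imCLM.compLeftContinuous ℝ PhaseCircle

/-- The superposition operator `u ↦ sin (x + u(x))`, written as `Im (e^{ix} e^{iu})` with the
exponential of the Banach algebra `C(PhaseCircle, ℂ)`. -/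
noncomputable def sinShift (u : C(PhaseCircle, ℝ)) : C(PhaseCircle, ℝ) :=
  circleIm (fourier 1 * NormedSpace.exp (circleMulI u))

theorem sinShift_coe (u : C(PhaseCircle, ℝ)) (x : ℝ) :
    sinShift u (x : PhaseCircle) = Real.sin (x + u (x : PhaseCircle)) := by
  have h : (NormedSpace.exp (circleMulI u)) (x : PhaseCircle)
      = Complex.exp (u (x : PhaseCircle) * Complex.I) := by
    have := NormedSpace.map_exp (ContinuousMap.evalAlgHom ℂ ℂ (x : PhaseCircle))
      (continuous_eval_const _) (circleMulI u)
    rw [← Complex.exp_eq_exp_ℂ] at this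
    simpa [circleMulI] using! this
  change (fourier 1 (x : PhaseCircle)
    * (NormedSpace.exp (circleMulI u)) (x : PhaseCircle)).im = _
  rw [h, fourier_coe_apply, ← Complex.exp_add]
  have : 2 * (Real.pi : ℂ) * Complex.I * ((1 : ℤ) : ℂ) * x / ((2 * Real.pi : ℝ) : ℂ)
      + u (x : PhaseCircle) * Complex.I = ((x + u (x : PhaseCircle) : ℝ) : ℂ) * Complex.I := by
    have : (Real.pi : ℂ) ≠ 0 := by exact_mod_cast Real.pi_ne_zero
    push_cast
    field_simp
  rw [this, Complex.exp_ofReal_mul_I_im]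

open scoped ContDiff in
theorem contDiff_sinShift : ContDiff ℝ ω sinShift := by
  have h : ContDiff ℝ ω (NormedSpace.exp : C(PhaseCircle, ℂ) → C(PhaseCircle, ℂ)) :=
    contDiff_iff_contDiffAt.2 fun x ↦ (NormedSpace.exp_analytic (𝕂 := ℝ) x).contDiffAt
  unfold sinShift
  refine circleIm.contDiff.comp (contDiff_const.mul (h.comp circleMulI.contDiff))

theorem norm_toCircleL2_sinShift_sub_le (u v : C(PhaseCircle, ℝ)) :
    ‖toCircleL2 (sinShift u - sinShift v)‖ ≤ ‖toCircleL2 (u - v)‖ := by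
  refine norm_toCircleL2_mono fun x ↦ ?_
  induction x using QuotientAddGroup.induction_on with
  | H x =>
    change |sinShift u (x : PhaseCircle) - sinShift v (x : PhaseCircle)|
      ≤ |u (x : PhaseCircle) - v (x : PhaseCircle)|
    rw [sinShift_coe, sinShift_coe]
    have := Real.abs_sin_sub_sin_le (x + u (x : PhaseCircle)) (x + v (x : PhaseCircle))
    simpa using this

theorem norm_toCircleL2_sinShift_le (u : C(PhaseCircle, ℝ)) : ‖toCircleL2 (sinShift u)‖ ≤ 1 := by
  rw [← norm_toCircleL2_one]
  refine norm_toCircleL2_mono fun x ↦ ?_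
  induction x using QuotientAddGroup.induction_on with
  | H x =>
    change |sinShift u (x : PhaseCircle)| ≤ |1|
    rw [sinShift_coe, abs_one]
    exact Real.abs_sin_le_one _

/-- `∫ sin θ θ' = 0` over a period, for `θ = x + u` and `θ' = 1 + v`. -/
theorem inner_sinShift_add_circleMean {u v : C(PhaseCircle, ℝ)}
    (h : ∀ x : ℝ, HasDerivAt (fun s : ℝ ↦ u (s : PhaseCircle)) (v (x : PhaseCircle)) x) :
    inner ℝ (toCircleL2 (sinShift u)) (toCircleL2 v) + circleMean (sinShift u) = 0 := by
  rw [inner_toCircleL2, ← circleMean_add]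
  have hc : Continuous fun s : ℝ ↦ -Real.cos (s + u (s : PhaseCircle)) :=
    (Real.continuous_cos.comp (continuous_id.add
      (u.continuous.comp (AddCircle.continuous_mk' _)))).neg
  have hp : Function.Periodic (fun s : ℝ ↦ -Real.cos (s + u (s : PhaseCircle))) (2 * Real.pi) :=
    fun s ↦ by
      have : s + 2 * Real.pi + u (s : PhaseCircle) = s + u (s : PhaseCircle) + 2 * Real.pi := by
        ring
      simp only [AddCircle.coe_add_period, this, Real.cos_add_two_pi]
  refine circleMean_eq_zero_of_hasDerivAt (U := circleLift _ hc hp) fun x ↦ ?_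
  have := (((hasDerivAt_id x).add (h x)).cos).neg
  convert! this using 1
  simp [sinShift_coe]
  ring

/-! ### Rotating waves as solutions of an equation in `L²` -/

theorem antiderivative_eq_of_hasDerivAt {U f : C(PhaseCircle, ℝ)}
    (hU : ∀ x : ℝ, HasDerivAt (fun s : ℝ ↦ U (s : PhaseCircle)) (f (x : PhaseCircle)) x)
    (h : circleMean U = 0) : antiderivative f = U :=
  antiderivative_eq (fun x ↦ by
    rw [circleMean_eq_zero_of_hasDerivAt hU, sub_zero]; exact hU x) h

/-- Removal of the mean value, that is, the orthogonal projection of `L²` off the constants. -/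
noncomputable def removeMean : CircleL2 →L[ℝ] CircleL2 :=
  ContinuousLinearMap.id ℝ CircleL2 - (innerSL ℝ (toCircleL2 1)).smulRight (toCircleL2 1)

theorem removeMean_apply (g : CircleL2) :
    removeMean g = g - (inner ℝ (toCircleL2 1) g : ℝ) • toCircleL2 1 := by
  simp [removeMean]

theorem norm_removeMean_le (g : CircleL2) : ‖removeMean g‖ ≤ ‖g‖ := by
  refine le_of_sq_le_sq ?_ (norm_nonneg _)
  rw [removeMean_apply, norm_sub_sq_real, real_inner_smul_right, norm_smul, norm_toCircleL2_one,
    real_inner_comm, mul_one, Real.norm_eq_abs, sq_abs]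
  nlinarith [sq_nonneg (inner ℝ (toCircleL2 1) g : ℝ)]

/-- The third mean-zero antiderivative, which recovers the periodic part `u` of a wave profile
from `u'''`. -/
noncomputable def thirdAntiderivative : CircleL2 →L[ℝ] C(PhaseCircle, ℝ) :=
  antiderivativeL2 ∘L circleInverse ∘L circleInverse

theorem toCircleL2_thirdAntiderivative (g : CircleL2) :
    toCircleL2 (thirdAntiderivative g) = circleInverse (circleInverse (circleInverse g)) := rfl

/-- The linear part `-βk²ω u''' + (ω² - k²) u'' + αω u'` of the traveling wave equation, as an
operator on `g = u'''`. -/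
noncomputable def waveOperator (α β k ω : ℝ) : CircleL2 →L[ℝ] CircleL2 :=
  skewQuadratic circleInverse (β * k ^ 2 * ω) (ω ^ 2 - k ^ 2) (α * ω)

/-- `g` is the third derivative of the periodic part `u` of a traveling wave `x + u(x)` with
`u` of mean zero; the equation holds up to a constant, which is the bias. -/
def IsProfile (α β k ω : ℝ) (g : CircleL2) : Prop :=
  waveOperator α β k ω g + removeMean (toCircleL2 (sinShift (thirdAntiderivative g))) = 0

/-- The bias of a traveling wave: the mean value of the traveling wave equation. -/
noncomputable def profileBias (α ω : ℝ) (g : CircleL2) : ℝ :=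
  α * ω + circleMean (sinShift (thirdAntiderivative g))

/-- Energy balance: the work done by the bias equals the dissipation. -/
theorem IsProfile.profileBias_eq {α β k ω : ℝ} {g : CircleL2} (h : IsProfile α β k ω g) :
    profileBias α ω g = α * ω + (β * k ^ 2 * ω * ‖circleInverse g‖ ^ 2
      + α * ω * ‖circleInverse (circleInverse g)‖ ^ 2) := by
  -- the inner product of the equation with `u' = circleInverse (circleInverse g)`
  have h1 := inner_skewQuadratic_apply_apply inner_circleInverse_self (β * k ^ 2 * ω)
    (ω ^ 2 - k ^ 2) (α * ω) g
  have h2 : skewQuadratic circleInverse (β * k ^ 2 * ω) (ω ^ 2 - k ^ 2) (α * ω) g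
      = -removeMean (toCircleL2 (sinShift (thirdAntiderivative g))) :=
    eq_neg_of_add_eq_zero_left h
  have h3 : ∀ x : ℝ, HasDerivAt (fun s : ℝ ↦ thirdAntiderivative g (s : PhaseCircle))
      (antiderivativeL2 (circleInverse g) (x : PhaseCircle)) x := fun x ↦ by
    have := hasDerivAt_antiderivative (antiderivativeL2 (circleInverse g)) x
    rwa [circleMean_eq_inner, ← circleInverse_apply, inner_one_circleInverse, sub_zero,
      ← antiderivativeL2_toCircleL2] at this
  have h4 := inner_sinShift_add_circleMean h3
  rw [h2, removeMean_apply, inner_neg_left, inner_sub_left, real_inner_smul_left,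
    inner_one_circleInverse, circleInverse_apply (circleInverse g)] at h1
  rw [profileBias, circleInverse_apply (circleInverse g)]
  linarith

theorem IsProfile.abs_mul_norm_le {α β k ω : ℝ} {g : CircleL2} (h : IsProfile α β k ω g) :
    |ω ^ 2 - k ^ 2| * ‖circleInverse g‖ ≤ 1 := by
  -- the inner product of the equation with `u'' = circleInverse g`
  have h1 := inner_skewQuadratic_apply inner_circleInverse_self (β * k ^ 2 * ω) (ω ^ 2 - k ^ 2)
    (α * ω) g
  have h2 : skewQuadratic circleInverse (β * k ^ 2 * ω) (ω ^ 2 - k ^ 2) (α * ω) g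
      = -removeMean (toCircleL2 (sinShift (thirdAntiderivative g))) :=
    eq_neg_of_add_eq_zero_left h
  rw [h2] at h1
  set N := ‖circleInverse g‖
  have h3 : |ω ^ 2 - k ^ 2| * N ^ 2 ≤ 1 * N := by
    rw [← abs_of_nonneg (sq_nonneg N), ← abs_mul, ← h1]
    refine (abs_real_inner_le_norm _ _).trans ?_
    rw [norm_neg]
    gcongr
    exact (norm_removeMean_le _).trans (norm_toCircleL2_sinShift_le _)
  rcases (norm_nonneg (circleInverse g)).eq_or_lt with h0 | h0
  · change 0 = N at h0
    rw [← h0, mul_zero]; exact zero_le_one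
  · refine le_of_mul_le_mul_right ?_ h0
    linarith [h3, sq N]

/-- The terms of the junction equation for `φ(x, t) = θ(kx + ωt)`. -/
theorem derivatives_travelingWave {θ θ₁ θ₂ θ₃ : ℝ → ℝ} (h1 : ∀ z, HasDerivAt θ (θ₁ z) z)
    (h2 : ∀ z, HasDerivAt θ₁ (θ₂ z) z) (h3 : ∀ z, HasDerivAt θ₂ (θ₃ z) z) (k ω x t : ℝ) :
    deriv (fun s ↦ θ (k * x + ω * s)) t = ω * θ₁ (k * x + ω * t) ∧
    deriv (deriv (fun s ↦ θ (k * x + ω * s))) t = ω ^ 2 * θ₂ (k * x + ω * t) ∧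
    deriv (deriv (fun y ↦ θ (k * y + ω * t))) x = k ^ 2 * θ₂ (k * x + ω * t) ∧
    deriv (fun s ↦ deriv (deriv (fun y ↦ θ (k * y + ω * s))) x) t
      = k ^ 2 * ω * θ₃ (k * x + ω * t) := by
  have aff : ∀ a b s : ℝ, HasDerivAt (fun s ↦ a * s + b) a s := fun a b s ↦ by
    simpa using ((hasDerivAt_id s).const_mul a).add_const b
  have D : ∀ {f f' : ℝ → ℝ}, (∀ z, HasDerivAt f (f' z) z) → ∀ a b c s : ℝ,
      HasDerivAt (fun s ↦ c * f (a * s + b)) (c * a * f' (a * s + b)) s := fun hf a b c s ↦ by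
    exact (((hf (a * s + b)).comp s (aff a b s)).const_mul c).congr_deriv (by ring)
  have t1 : deriv (fun s ↦ θ (k * x + ω * s)) = fun s ↦ ω * θ₁ (ω * s + k * x) := by
    ext s
    have := (D h1 ω (k * x) 1 s).deriv
    simpa [add_comm] using this
  have x1 : ∀ s, deriv (fun y ↦ θ (k * y + ω * s)) = fun y ↦ k * θ₁ (k * y + ω * s) := fun s ↦ by
    ext y
    simpa using (D h1 k (ω * s) 1 y).deriv
  have x2 : ∀ s, deriv (deriv (fun y ↦ θ (k * y + ω * s))) x
      = k ^ 2 * θ₂ (ω * s + k * x) := fun s ↦ by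
    rw [x1, (D h2 k (ω * s) k x).deriv, sq, add_comm]
  refine ⟨by rw [t1, add_comm], ?_, by rw [x2, add_comm], ?_⟩
  · rw [t1, (D h2 ω (k * x) ω t).deriv, sq, add_comm]
  · simp_rw [x2]
    rw [(D h3 ω (k * x) (k ^ 2) t).deriv, add_comm]

theorem exists_isProfile_of_meanZero {α β γ k ω : ℝ} {θ θ₁ θ₂ θ₃ : ℝ → ℝ}
    (h1 : ∀ z, HasDerivAt θ (θ₁ z) z) (h2 : ∀ z, HasDerivAt θ₁ (θ₂ z) z)
    (h3 : ∀ z, HasDerivAt θ₂ (θ₃ z) z) (hc : Continuous θ₃)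
    (hper : ∀ z, θ (z + 2 * Real.pi) = θ z + 2 * Real.pi)
    (hmean : ∫ z in (0 : ℝ)..2 * Real.pi, (θ z - z) = 0)
    (heq : ∀ z, ω ^ 2 * θ₂ z + α * (ω * θ₁ z) + Real.sin (θ z)
      = k ^ 2 * θ₂ z + β * (k ^ 2 * ω * θ₃ z) + γ) :
    ∃ g, IsProfile α β k ω g ∧ γ = profileBias α ω g := by
  have cont : ∀ {f f' : ℝ → ℝ}, (∀ z, HasDerivAt f (f' z) z) → Continuous f := fun h ↦
    continuous_iff_continuousAt.2 fun x ↦ (h x).continuousAt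
  have per : ∀ {f f' : ℝ → ℝ}, (∀ z, HasDerivAt f (f' z) z) → ∀ r,
      (∀ z, f (z + 2 * Real.pi) = f z + r) → Function.Periodic f' (2 * Real.pi) := by
    intro f f' h r hr z
    have e1 : HasDerivAt (fun z ↦ f (z + 2 * Real.pi)) (f' (z + 2 * Real.pi)) z :=
      (h (z + 2 * Real.pi)).comp_add_const z (2 * Real.pi)
    have e2 : HasDerivAt (fun z ↦ f (z + 2 * Real.pi)) (f' z) z := by
      simp_rw [hr]; exact (h z).add_const r
    exact e1.unique e2
  have p1 := per h1 _ hper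
  have p2 := per h2 0 (fun z ↦ by rw [p1, add_zero])
  have p3 := per h3 0 (fun z ↦ by rw [p2, add_zero])
  let u := circleLift (fun z ↦ θ z - z) ((cont h1).sub continuous_id) (fun z ↦ by
    simp only [hper]; ring)
  let u₁ := circleLift (fun z ↦ θ₁ z - 1) ((cont h2).sub continuous_const) (fun z ↦ by
    simp only [p1 z])
  let u₂ := circleLift θ₂ (cont h3) p2
  let u₃ := circleLift θ₃ hc p3
  have d0 : ∀ x : ℝ, HasDerivAt (fun s : ℝ ↦ u (s : PhaseCircle)) (u₁ (x : PhaseCircle)) x :=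
    fun x ↦ (h1 x).sub (hasDerivAt_id x)
  have d1 : ∀ x : ℝ, HasDerivAt (fun s : ℝ ↦ u₁ (s : PhaseCircle)) (u₂ (x : PhaseCircle)) x :=
    fun x ↦ (h2 x).sub_const 1
  have d2 : ∀ x : ℝ, HasDerivAt (fun s : ℝ ↦ u₂ (s : PhaseCircle)) (u₃ (x : PhaseCircle)) x :=
    h3
  have m0 : circleMean u = 0 := by
    rw [circleMean_eq_intervalIntegral]
    exact mul_eq_zero_of_right _ hmean
  have m1 := circleMean_eq_zero_of_hasDerivAt d0
  have m2 := circleMean_eq_zero_of_hasDerivAt d1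
  have m3 := circleMean_eq_zero_of_hasDerivAt d2
  have A3 : antiderivativeL2 (toCircleL2 u₃) = u₂ := by
    rw [antiderivativeL2_toCircleL2, antiderivative_eq_of_hasDerivAt d2 m2]
  have A2 : antiderivativeL2 (toCircleL2 u₂) = u₁ := by
    rw [antiderivativeL2_toCircleL2, antiderivative_eq_of_hasDerivAt d1 m1]
  have A1 : antiderivativeL2 (toCircleL2 u₁) = u := by
    rw [antiderivativeL2_toCircleL2, antiderivative_eq_of_hasDerivAt d0 m0]
  have hJ : thirdAntiderivative (toCircleL2 u₃) = u := by
    simp only [thirdAntiderivative, ContinuousLinearMap.comp_apply, circleInverse_apply, A3, A2, A1]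
  have hE : -((β * k ^ 2 * ω) • u₃) + (ω ^ 2 - k ^ 2) • u₂ + (α * ω) • u₁ + sinShift u
      = (γ - α * ω) • (1 : C(PhaseCircle, ℝ)) := circle_ext fun x ↦ by
    have := heq x
    simp only [ContinuousMap.add_apply, ContinuousMap.neg_apply, ContinuousMap.smul_apply,
      sinShift_coe, ContinuousMap.one_apply, smul_eq_mul]
    change -(β * k ^ 2 * ω * θ₃ x) + (ω ^ 2 - k ^ 2) * θ₂ x + α * ω * (θ₁ x - 1)
      + Real.sin (x + (θ x - x)) = (γ - α * ω) * 1
    rw [add_sub_cancel]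
    linarith
  have hm : circleMean (sinShift u) = γ - α * ω := by
    have := congrArg circleMean hE
    rwa [circleMean_add, circleMean_add, circleMean_add, ← neg_smul, circleMean_smul,
      circleMean_smul, circleMean_smul, circleMean_smul, m1, m2, m3, circleMean_one, mul_zero,
      mul_zero, mul_zero, add_zero, add_zero, zero_add, mul_one] at this
  refine ⟨toCircleL2 u₃, ?_, by rw [profileBias, hJ, hm]; ring⟩
  have := congrArg toCircleL2 hE
  simp only [map_add, map_neg, map_smul] at this
  rw [IsProfile, waveOperator, skewQuadratic_apply, hJ, removeMean_apply, ← circleMean_eq_inner, hm]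
  simp only [circleInverse_apply, A3, A2]
  rw [← this]
  abel

/-- Every rotating wave, for any real `ω`, comes from a profile: the wave number is `2π / L`, and a
translation makes `θ z - z` of mean zero. -/
theorem exists_isProfile_of_wave {L α β γ ω : ℝ} (hL : 0 < L) {φ : ℝ → ℝ → ℝ}
    (h : IsRotatingFluxonWave L α β γ ω φ) :
    ∃ g, IsProfile α β (2 * Real.pi / L) ω g ∧ γ = profileBias α ω g := by
  obtain ⟨⟨hC, hsol⟩, hann, k, θ, hper, hφ⟩ := h
  have hk0 : k ≠ 0 := by
    rintro rfl
    have := hann 0 0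
    simp only [hφ, zero_mul] at this
    linarith [Real.two_pi_pos]
  have hθ : ContDiff ℝ 3 θ := by
    have e : θ = fun z ↦ (fun p : ℝ × ℝ ↦ φ p.1 p.2) (z / k, 0) := by
      ext z
      simp only [hφ, mul_zero, add_zero]
      rw [mul_div_cancel₀ _ hk0]
    rw [e]
    exact hC.comp ((contDiff_id.div_const k).prodMk contDiff_const)
  have hgc : Continuous fun z ↦ θ z - z := hθ.continuous.sub continuous_id
  have hgp : Function.Periodic (fun z ↦ θ z - z) (2 * Real.pi) := fun z ↦ by
    simp only [hper]; ring
  have hshift : ∀ r, ∫ z in (0 : ℝ)..2 * Real.pi, (θ (z + r) - (z + r))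
      = ∫ z in (0 : ℝ)..2 * Real.pi, (θ z - z) := fun r ↦ by
    rw [intervalIntegral.integral_comp_add_right (fun z ↦ θ z - z), zero_add, add_comm _ r,
      hgp.intervalIntegral_add_eq r 0, zero_add]
  -- `z ↦ θ z - z` is periodic, so its mean does not change under the translation by `k L`
  have hk : k = 2 * Real.pi / L := by
    have hkL : ∀ z, θ (z + k * L) = θ z + 2 * Real.pi := fun z ↦ by
      have := hann (z / k) 0
      simp only [hφ, mul_zero, add_zero, mul_add, mul_div_cancel₀ _ hk0] at this
      exact this
    have h1 := hshift (k * L)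
    have h2 : ∀ z, θ (z + k * L) - (z + k * L) = (θ z - z) + (2 * Real.pi - k * L) := fun z ↦ by
      rw [hkL]; ring
    simp_rw [h2] at h1
    rw [intervalIntegral.integral_add (hgc.intervalIntegrable _ _) (by simp),
      intervalIntegral.integral_const, sub_zero, smul_eq_mul] at h1
    have h3 : 2 * Real.pi * (2 * Real.pi - k * L) = 0 := by linarith
    rw [eq_div_iff hL.ne']
    linarith [(mul_eq_zero.1 h3).resolve_left Real.two_pi_pos.ne']
  rw [← hk]
  set m := (2 * Real.pi)⁻¹ * ∫ z in (0 : ℝ)..2 * Real.pi, (θ z - z) with hm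
  have hd1 := contDiff_succ_iff_deriv.1 (show ContDiff ℝ (2 + 1) θ from hθ)
  have hd2 := contDiff_succ_iff_deriv.1 (show ContDiff ℝ (1 + 1) (deriv θ) from hd1.2.2)
  have hd3 := contDiff_succ_iff_deriv.1 (show ContDiff ℝ (0 + 1) (deriv (deriv θ)) from hd2.2.2)
  have sh : ∀ {f : ℝ → ℝ}, Differentiable ℝ f → ∀ z,
      HasDerivAt (fun z ↦ f (z + -m)) (deriv f (z + -m)) z := fun hf z ↦
    (hf (z + -m)).hasDerivAt.comp_add_const z (-m)
  refine exists_isProfile_of_meanZero (θ := fun z ↦ θ (z + -m)) (sh hd1.1) (sh hd2.1) (sh hd3.1)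
    (hd3.2.2.continuous.comp (continuous_id.add continuous_const))
    (fun z ↦ by rw [add_right_comm, hper]) ?_ fun z ↦ ?_
  · have e : ∀ z, θ (z + -m) - z = (θ (z + -m) - (z + -m)) + -m := fun z ↦ by ring
    simp_rw [e]
    rw [intervalIntegral.integral_add, hshift, intervalIntegral.integral_const, sub_zero,
      smul_eq_mul, hm]
    · field_simp
      ring
    · exact (hgc.comp (continuous_id.add continuous_const)).intervalIntegrable _ _
    · simp
  · have hs := hsol ((z + -m) / k) 0
    simp only [hφ] at hs
    obtain ⟨e1, e2, e3, e4⟩ := derivatives_travelingWave (fun z ↦ (hd1.1 z).hasDerivAt)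
      (fun z ↦ (hd2.1 z).hasDerivAt) (fun z ↦ (hd3.1 z).hasDerivAt) k ω ((z + -m) / k) 0
    rw [e1, e2, e3, e4, mul_zero, add_zero, mul_div_cancel₀ _ hk0] at hs
    exact hs

/-- A profile in `L²` is a classical wave: since `βk²ω ≠ 0`, the equation itself shows that `g` is
continuous. -/
theorem exists_wave_of_isProfile {L α β ω : ℝ} (hL : 0 < L) (hβ : 0 < β) (hω : 0 < ω)
    {g : CircleL2} (hg : IsProfile α β (2 * Real.pi / L) ω g) :
    ∃ φ, IsRotatingFluxonWave L α β (profileBias α ω g) ω φ := by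
  set k := 2 * Real.pi / L with hk
  have hk0 : 0 < k := by positivity
  set u := thirdAntiderivative g with hu
  set a := β * k ^ 2 * ω with ha
  have ha0 : 0 < a := by positivity
  set mS := circleMean (sinShift u) with hmS
  -- the equation expresses `g` through continuous functions
  set f : C(PhaseCircle, ℝ) := a⁻¹ • ((ω ^ 2 - k ^ 2) • antiderivativeL2 g
    + (α * ω) • antiderivativeL2 (circleInverse g) + sinShift u + (-mS) • 1) with hf
  have hgf : g = toCircleL2 f := by
    rw [IsProfile, waveOperator, skewQuadratic_apply, ← hu, removeMean_apply,
      ← circleMean_eq_inner, ← hmS] at hg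
    rw [hf, map_smul, eq_inv_smul_iff₀ ha0.ne', map_add, map_add, map_add, map_smul, map_smul,
      map_smul, ← circleInverse_apply, ← circleInverse_apply, ← sub_eq_zero, ← neg_eq_zero, ← hg]
    simp only [neg_smul]
    abel
  have hA : ∀ h : C(PhaseCircle, ℝ), circleMean (antiderivative h) = 0 :=
    circleMean_antiderivative
  set u₂ := antiderivative f with hu₂
  set u₁ := antiderivative u₂ with hu₁
  have e2 : antiderivativeL2 g = u₂ := by rw [hgf, antiderivativeL2_toCircleL2]
  have e1 : antiderivativeL2 (circleInverse g) = u₁ := by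
    rw [circleInverse_apply, e2, antiderivativeL2_toCircleL2]
  have e0 : u = antiderivative u₁ := by
    rw [hu, thirdAntiderivative, ContinuousLinearMap.comp_apply, ContinuousLinearMap.comp_apply,
      circleInverse_apply (circleInverse g), e1, antiderivativeL2_toCircleL2]
  have mf : circleMean f = 0 := by
    rw [hf, circleMean_smul, circleMean_add, circleMean_add, circleMean_add, circleMean_smul,
      circleMean_smul, circleMean_smul, e2, e1, hA, hA, circleMean_one]
    ring
  have d2 : ∀ x : ℝ, HasDerivAt (fun s : ℝ ↦ u₂ (s : PhaseCircle)) (f (x : PhaseCircle)) x :=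
    fun x ↦ by have := hasDerivAt_antiderivative f x; rwa [mf, sub_zero] at this
  have d1 : ∀ x : ℝ, HasDerivAt (fun s : ℝ ↦ 1 + u₁ (s : PhaseCircle)) (u₂ (x : PhaseCircle)) x :=
    fun x ↦ by
      have := (hasDerivAt_antiderivative u₂ x).const_add 1
      rwa [hA, sub_zero] at this
  have d0 : ∀ x : ℝ,
      HasDerivAt (fun s : ℝ ↦ s + u (s : PhaseCircle)) (1 + u₁ (x : PhaseCircle)) x :=
    fun x ↦ by
      have := (hasDerivAt_id x).add (hasDerivAt_antiderivative u₁ x)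
      rw [hA, sub_zero, ← e0] at this
      exact this
  have hC : ContDiff ℝ 3 fun s : ℝ ↦ s + u (s : PhaseCircle) := by
    have step : ∀ {n : ℕ} {F F' : ℝ → ℝ}, (∀ x, HasDerivAt F (F' x) x) → ContDiff ℝ n F' →
        ContDiff ℝ ((n + 1 : ℕ) : WithTop ℕ∞) F := fun {n F F'} h h' ↦ by
      rw [Nat.cast_add, Nat.cast_one]
      refine contDiff_succ_iff_deriv.2 ⟨fun x ↦ (h x).differentiableAt, by simp, ?_⟩
      rwa [show deriv F = F' from funext fun x ↦ (h x).deriv]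
    refine step d0 (step d1 (step d2 (n := 0) ?_))
    exact contDiff_zero.2 (f.continuous.comp (AddCircle.continuous_mk' _))
  refine ⟨fun x t ↦ (k * x + ω * t) + u ((k * x + ω * t : ℝ) : PhaseCircle),
    ⟨?_, fun x t ↦ ?_⟩, fun x t ↦ ?_, k, fun s ↦ s + u (s : PhaseCircle), fun z ↦ ?_,
    fun x t ↦ rfl⟩
  · exact hC.comp ((contDiff_const.mul contDiff_fst).add (contDiff_const.mul contDiff_snd))
  · obtain ⟨q1, q2, q3, q4⟩ := derivatives_travelingWave d0 d1 d2 k ω x t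
    rw [q1, q2, q3, q4]
    set z := k * x + ω * t
    have hfz : a * f (z : PhaseCircle) = (ω ^ 2 - k ^ 2) * u₂ (z : PhaseCircle)
        + α * ω * u₁ (z : PhaseCircle) + Real.sin (z + u (z : PhaseCircle)) - mS := by
      rw [hf, e2, e1]
      simp only [ContinuousMap.add_apply, ContinuousMap.smul_apply, smul_eq_mul, sinShift_coe,
        ContinuousMap.one_apply]
      rw [mul_inv_cancel_left₀ ha0.ne']
      ring
    rw [profileBias, ← hu, ← hmS]
    rw [ha] at hfz
    linarith
  · have : k * (x + L) + ω * t = (k * x + ω * t) + 2 * Real.pi := by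
      rw [hk]; field_simp; ring
    simp only [this, AddCircle.coe_add_period]
    ring
  · simp only [AddCircle.coe_add_period]
    ring

/-! ### The bias as a function of the frequency -/

/-- With `α + βk² ≥ √2 k` the right-hand side is at least `ω⁴ + k⁴`. -/
theorem sq_le_waveSymbol {α β k ω : ℝ} (hk : 0 ≤ k)
    (hαβ : Real.sqrt 2 * k ≤ α + β * k ^ 2) :
    (k ^ 2) ^ 2 ≤ (β * k ^ 2 * ω + α * ω) ^ 2 + (ω ^ 2 - k ^ 2) ^ 2 := by
  have h1 : (Real.sqrt 2 * k) ^ 2 ≤ (α + β * k ^ 2) ^ 2 := by gcongr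
  rw [mul_pow, Real.sq_sqrt (by norm_num)] at h1
  have h2 := mul_le_mul_of_nonneg_right h1 (sq_nonneg ω)
  nlinarith [sq_nonneg (ω ^ 2)]

theorem mul_norm_thirdAntiderivative_le {α β k ω : ℝ} (hα : 0 ≤ α) (hβ : 0 ≤ β) (hk : 0 ≤ k)
    (hαβ : Real.sqrt 2 * k ≤ α + β * k ^ 2) (g : CircleL2) :
    k ^ 2 * ‖toCircleL2 (thirdAntiderivative g)‖ ≤ ‖waveOperator α β k ω g‖ := by
  rw [toCircleL2_thirdAntiderivative]
  refine mul_norm_le_norm_skewQuadratic inner_circleInverse_self norm_circleInverse_le ?_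
    (sq_le_waveSymbol hk hαβ) g
  have : β * k ^ 2 * ω * (α * ω) = β * k ^ 2 * α * ω ^ 2 := by ring
  rw [this]
  positivity

theorem exists_equiv_waveOperator {α β k ω : ℝ} (hα : 0 < α) (hβ : 0 < β) (hk : 0 < k)
    (hω : 0 < ω) :
    ∃ e : CircleL2 ≃L[ℝ] CircleL2, (e : CircleL2 →L[ℝ] CircleL2) = waveOperator α β k ω :=
  exists_equiv_skewQuadratic inner_circleInverse_self (by positivity) _ (by positivity)

theorem injective_waveOperator {α β k ω : ℝ} (hα : 0 < α) (hβ : 0 < β) (hk : 0 < k)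
    (hω : 0 < ω) : Function.Injective (waveOperator α β k ω) := by
  obtain ⟨e, he⟩ := exists_equiv_waveOperator hα hβ hk hω
  rw [← he]
  exact e.injective

theorem exists_isProfile {α β k ω : ℝ} (hα : 0 < α) (hβ : 0 < β) (hk : 1 < k)
    (hαβ : Real.sqrt 2 * k ≤ α + β * k ^ 2) (hω : 0 < ω) : ∃ g, IsProfile α β k ω g := by
  have hk0 : 0 < k := one_pos.trans hk
  obtain ⟨e, he⟩ := exists_equiv_waveOperator hα hβ hk0 hω
  obtain ⟨g, hg⟩ := exists_semilinear e (κ := k ^ 2) (one_lt_pow₀ hk two_ne_zero)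
    (ι := toCircleL2) (J := thirdAntiderivative) (S := sinShift) (P := removeMean)
    (fun g ↦ by
      rw [← ContinuousLinearEquiv.coe_coe, he]
      exact mul_norm_thirdAntiderivative_le hα.le hβ.le hk0.le hαβ g)
    norm_removeMean_le norm_toCircleL2_sinShift_sub_le
  refine ⟨g, ?_⟩
  rw [← ContinuousLinearEquiv.coe_coe, he] at hg
  exact hg

theorem IsProfile.unique {α β k ω : ℝ} (hα : 0 < α) (hβ : 0 < β) (hk : 1 < k)
    (hαβ : Real.sqrt 2 * k ≤ α + β * k ^ 2) (hω : 0 < ω) {g h : CircleL2}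
    (hg : IsProfile α β k ω g) (hh : IsProfile α β k ω h) : g = h :=
  eq_of_semilinear (injective_waveOperator hα hβ (one_pos.trans hk) hω)
    (one_lt_pow₀ hk two_ne_zero)
    (mul_norm_thirdAntiderivative_le hα.le hβ.le (one_pos.trans hk).le hαβ)
    norm_removeMean_le norm_toCircleL2_sinShift_sub_le hg hh

theorem contDiff_waveOperator (α β k : ℝ) {n : WithTop ℕ∞} : ContDiff ℝ n (waveOperator α β k) := by
  unfold waveOperator skewQuadratic
  fun_prop

theorem analyticAt_profileBias {α β k t : ℝ} (hα : 0 < α) (hβ : 0 < β) (hk : 1 < k)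
    (hαβ : Real.sqrt 2 * k ≤ α + β * k ^ 2) (ht : 0 < t) {g : ℝ → CircleL2}
    (hg : ∀ s, 0 < s → IsProfile α β k s (g s)) :
    AnalyticAt ℝ (fun s ↦ profileBias α s (g s)) t := by
  have hk0 : 0 < k := one_pos.trans hk
  obtain ⟨e, he⟩ := exists_equiv_waveOperator hα hβ hk0 ht
  have hgan : AnalyticAt ℝ g t := by
    refine analyticAt_semilinear (ι := toCircleL2) (J := thirdAntiderivative) (S := sinShift)
      (P := removeMean) (M := waveOperator α β k) (one_lt_pow₀ hk two_ne_zero) ?_ e he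
      (contDiff_waveOperator α β k) norm_removeMean_le norm_toCircleL2_sinShift_sub_le
      contDiff_sinShift ?_
    · filter_upwards [lt_mem_nhds ht] with s hs
      exact ⟨injective_waveOperator hα hβ hk0 hs,
        mul_norm_thirdAntiderivative_le hα.le hβ.le hk0.le hαβ⟩
    · filter_upwards [lt_mem_nhds ht] with s hs using hg s hs
  have hS := contDiff_sinShift
  have hgc := hgan.contDiffAt (n := ⊤)
  refine ContDiffAt.analyticAt ?_
  simp only [profileBias, circleMean_eq_inner]
  refine (contDiffAt_const.mul contDiffAt_id).add (contDiffAt_const.inner ℝ ?_)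
  exact toCircleL2.contDiff.contDiffAt.comp t (hS.contDiffAt.comp t
    (thirdAntiderivative.contDiff.contDiffAt.comp t hgc))

theorem IsProfile.le_profileBias {α β k ω : ℝ} {g : CircleL2} (h : IsProfile α β k ω g)
    (hα : 0 ≤ α) (hβ : 0 ≤ β) (hω : 0 ≤ ω) : α * ω ≤ profileBias α ω g := by
  rw [h.profileBias_eq]
  exact le_add_of_nonneg_right (by positivity)

theorem IsProfile.profileBias_nonpos {α β k ω : ℝ} {g : CircleL2} (h : IsProfile α β k ω g)
    (hα : 0 ≤ α) (hβ : 0 ≤ β) (hω : ω ≤ 0) : profileBias α ω g ≤ 0 := by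
  have e : profileBias α ω g = ω * (α + (β * k ^ 2 * ‖circleInverse g‖ ^ 2
      + α * ‖circleInverse (circleInverse g)‖ ^ 2)) := by
    rw [h.profileBias_eq]; ring
  rw [e]
  exact mul_nonpos_of_nonpos_of_nonneg hω (by positivity)

theorem IsProfile.profileBias_le {α β k ω : ℝ} {g : CircleL2} (h : IsProfile α β k ω g)
    (hα : 0 ≤ α) (hβ : 0 ≤ β) (hω : 0 ≤ ω) (hk : 1 ≤ k) (hωk : ω ≤ 1 / 2) :
    profileBias α ω g ≤ (5 * α + 4 * (β * k ^ 2)) * ω := by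
  have hb : (1 / 2 : ℝ) ≤ |ω ^ 2 - k ^ 2| := by
    rw [abs_sub_comm]
    exact (by nlinarith : (1 / 2 : ℝ) ≤ k ^ 2 - ω ^ 2).trans (le_abs_self _)
  have h1 : ‖circleInverse g‖ ≤ 2 := by
    nlinarith [h.abs_mul_norm_le, norm_nonneg (circleInverse g)]
  have h2 := (norm_circleInverse_le (circleInverse g)).trans h1
  have h3 : ‖circleInverse g‖ ^ 2 ≤ 2 ^ 2 := by gcongr
  have h4 : ‖circleInverse (circleInverse g)‖ ^ 2 ≤ 2 ^ 2 := by gcongr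
  rw [h.profileBias_eq]
  calc _ ≤ α * ω + (β * k ^ 2 * ω * 2 ^ 2 + α * ω * 2 ^ 2) := by gcongr
    _ = _ := by ring

theorem theorem3 (L α β : ℝ) (hL : 0 < L) (hα : 0 < α) (hβ : 0 < β)
    (hk : 1 < 2 * Real.pi / L)
    (hαβ : Real.sqrt 2 * (2 * Real.pi / L) ≤ α + β * (2 * Real.pi / L) ^ 2) :
    (∃ γbar : ℝ → ℝ,
      Set.MapsTo γbar (Set.Ici 0) (Set.Ici 0) ∧
      ContinuousOn γbar (Set.Ici 0) ∧
      AnalyticOnNhd ℝ γbar (Set.Ioi 0) ∧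
      γbar 0 = 0 ∧
      Filter.Tendsto γbar Filter.atTop Filter.atTop ∧
      biasFrequencyCharacteristic L α β = {p | ∃ ω : ℝ, 0 < ω ∧ p = (ω, γbar ω)} ∧
      ∀ γ : ℝ, 0 < γ → ∀ ω : ℝ,
        (∃ φ : ℝ → ℝ → ℝ, IsRotatingFluxonWave L α β γ ω φ) ↔ (0 ≤ ω ∧ γbar ω = γ)) ∧
    IsConnected (biasFrequencyCharacteristic L α β) := by
  set k := 2 * Real.pi / L with hkdef
  have hex : ∀ ω : ℝ, ∃ g, 0 < ω → IsProfile α β k ω g := fun ω ↦ by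
    by_cases hω : 0 < ω
    · obtain ⟨g, hg⟩ := exists_isProfile hα hβ hk hαβ hω
      exact ⟨g, fun _ ↦ hg⟩
    · exact ⟨0, fun h ↦ absurd h hω⟩
  choose g hg using hex
  let γbar : ℝ → ℝ := fun ω ↦ if 0 < ω then profileBias α ω (g ω) else 0
  have hpos : ∀ ω, 0 < ω → γbar ω = profileBias α ω (g ω) := fun ω hω ↦ if_pos hω
  have h0 : γbar 0 = 0 := if_neg (lt_irrefl 0)
  have hlow : ∀ ω, 0 < ω → α * ω ≤ γbar ω := fun ω hω ↦ by
    rw [hpos ω hω]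
    exact (hg ω hω).le_profileBias hα.le hβ.le hω.le
  have hnonneg : ∀ ω, 0 ≤ ω → 0 ≤ γbar ω := fun ω hω ↦ by
    rcases hω.eq_or_lt with rfl | hω
    · exact h0.ge
    · exact (by positivity : 0 ≤ α * ω).trans (hlow ω hω)
  have han : AnalyticOnNhd ℝ γbar (Set.Ioi 0) := fun t ht ↦ by
    refine (analyticAt_profileBias hα hβ hk hαβ ht hg).congr ?_
    filter_upwards [lt_mem_nhds ht] with s hs using (hpos s hs).symm
  have hwave : ∀ γ : ℝ, 0 < γ → ∀ ω : ℝ,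
      (∃ φ : ℝ → ℝ → ℝ, IsRotatingFluxonWave L α β γ ω φ) ↔ (0 ≤ ω ∧ γbar ω = γ) := by
    intro γ hγ ω
    constructor
    · rintro ⟨φ, hφ⟩
      obtain ⟨h, hh, rfl⟩ := exists_isProfile_of_wave hL hφ
      have hω : 0 < ω := by
        by_contra hω
        exact absurd hγ (hh.profileBias_nonpos hα.le hβ.le (not_lt.1 hω)).not_gt
      rw [hpos ω hω, (hg ω hω).unique hα hβ hk hαβ hω hh]
      exact ⟨hω.le, rfl⟩
    · rintro ⟨hω, rfl⟩
      have hω : 0 < ω := hω.lt_of_ne fun h ↦ by rw [← h, h0] at hγ; exact lt_irrefl _ hγ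
      rw [hpos ω hω]
      exact exists_wave_of_isProfile hL hβ hω (hg ω hω)
  have hχ : biasFrequencyCharacteristic L α β = {p | ∃ ω : ℝ, 0 < ω ∧ p = (ω, γbar ω)} := by
    ext ⟨ω, γ⟩
    simp only [biasFrequencyCharacteristic, Set.mem_ofPred_eq, Prod.mk.injEq]
    constructor
    · rintro ⟨hω, hγ, hφ⟩
      exact ⟨ω, hω, rfl, ((hwave γ hγ ω).1 hφ).2.symm⟩
    · rintro ⟨ω, hω, rfl, rfl⟩
      have hγ : 0 < γbar ω := (by positivity : 0 < α * ω).trans_le (hlow ω hω)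
      exact ⟨hω, hγ, (hwave _ hγ ω).2 ⟨hω.le, rfl⟩⟩
  refine ⟨⟨γbar, fun ω hω ↦ hnonneg ω hω, fun t ht ↦ ?_, han, h0, ?_, hχ, hwave⟩, ?_⟩
  · rcases (Set.mem_Ici.1 ht).eq_or_lt with rfl | ht
    · rw [ContinuousWithinAt, h0]
      have hlim : Tendsto (fun ω : ℝ ↦ (5 * α + 4 * (β * k ^ 2)) * ω) (𝓝[≥] 0) (𝓝 0) := by
        have : Continuous fun ω : ℝ ↦ (5 * α + 4 * (β * k ^ 2)) * ω := by fun_prop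
        simpa using (this.tendsto 0).mono_left nhdsWithin_le_nhds
      refine tendsto_of_tendsto_of_tendsto_of_le_of_le' tendsto_const_nhds hlim ?_ ?_
      · filter_upwards [self_mem_nhdsWithin] with ω hω using hnonneg ω hω
      · filter_upwards [self_mem_nhdsWithin,
          nhdsWithin_le_nhds (gt_mem_nhds (by norm_num : (0 : ℝ) < 1 / 2))] with ω hω hω'
        rcases (Set.mem_Ici.1 hω).eq_or_lt with rfl | hω
        · rw [h0, mul_zero]
        · rw [hpos ω hω]
          exact (hg ω hω).profileBias_le hα.le hβ.le hω.le hk.le hω'.le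
    · exact (han t ht).continuousAt.continuousWithinAt
  · refine tendsto_atTop_mono' atTop ?_ (tendsto_id.const_mul_atTop hα)
    filter_upwards [eventually_gt_atTop 0] with ω hω using hlow ω hω
  · have : biasFrequencyCharacteristic L α β = (fun ω ↦ (ω, γbar ω)) '' Set.Ioi 0 := by
      rw [hχ]
      ext p
      simp only [Set.mem_ofPred_eq, Set.mem_image, Set.mem_Ioi, eq_comm]
    rw [this]
    exact isConnected_Ioi.image _ (continuousOn_id.prodMk han.continuousOn)
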